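/- Let $1\le m\le T$ be integers, $\mathcal T=\{1,\dots,T\}$, and let $Z^1,\dots,Z^T$ be deterministic sets with $Z^\tau\subseteq\mathbb R\times\mathbb R^{n_\tau}\times\mathbb R^m$, whose elements are written $(r,\mathbf x,\mathbf y)$ (reward, auxiliary variables, impact). Let $\Psi\subseteq\mathbb R^m$. Assume: **A1.** There are $(r^\tau,\mathbf x^\tau,\mathbf y^\tau)\in Z^\tau$ $(\tau\in\mathcal T)$ with $\sum_\tau \mathbf y^\tau\in T\Psi$; every $Z^\tau$ is compact; and $\Psi=Q+C$ with $Q$ compact and convex and $C$ a closed convex cone. **A2.** There are constants $d_y,d_r\ge 0$ and $\underline d>0$ such that for every $\tau$: (a) $\|\mathbf y-\mathbf v\|_\infty\le d_y$ for all $(r,\mathbf x,\mathbf y)\in Z^\tau$ and $\mathbf v\in Q$; (b) there is $(\tilde r,\tilde{\mathbf x},\tilde{\mathbf y})\in\operatorname{conv}(Z^\tau)$ with $\tilde r\ge \max_{(r,\mathbf x,\mathbf y)\in Z^\tau} r-d_r$ such that the closed Euclidean ball of radius $\underline d$ around $\tilde{\mathbf y}$ is contained in $\Psi$. Let $$z^R=\max\Big\{\sum_{\tau=1}^T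 r^\tau:\ (r^\tau,\mathbf x^\tau,\mathbf y^\tau)\in\operatorname{conv}(Z^\tau)\ (\tau\in\mathcal T),\ \sum_{\tau=1}^T\mathbf y^\tau\in T\Psi\Big\}.$$ (This maximum is attained.) Let $\pi$ be a uniformly random permutation of $\mathcal T$ and let the set $\Omega^t=Z^{\pi(t)}$ be revealed at time $t$. Consider the algorithm that starts at $\mathbf p^1=\mathbf 0$ and, for $t=1,\dots,T$, picks $$(\hat r^t,\hat{\mathbf x}^t,\hat{\mathbf y}^t)\in\arg\max\{r-(\mathbf p^t)^\top\mathbf y:(r,\mathbf x,\mathbf y)\in\Omega^t\},\qquad \hat{\mathbf v}^t\in\arg\max_{\mathbf v\in Q}(\mathbf p^t)^\top\mathbf v,$$ and sets $\mathbf p^{t+1}=\operatorname{proj}_{C^\circ}\big(\mathbf p^t-\eta^t(\hat{\mathbf v}^t-\hat{\mathbf y}^t)\big)$, where $\eta^t=\min\{1/m,\,1/\sqrt{mt}\}$, $C^\circ=\{\mathbf u:\mathbf u^\top\mathbf v\le 0\ \forall\,\mathbf v\in C\}$ and $\operatorname{proj}$ is the Euclidean projection. Ties between maximizers are broken by an arbitrary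 rule for which the choices at time $t$ depend only on $\pi(1),\dots,\pi(t)$. Then there is a constant $K>0$, depending only on $d_y,d_r,\underline d$, such that for every $\rho\in(0,1]$, with probability at least $1-\rho$ over $\pi$, $$\sum_{t=1}^T\hat r^t\ \ge\ z^R-K\Big(\sqrt{m\log m}\,\sqrt T+\sqrt{mT\log(T/\rho)}\Big).$$ -/

import Mathlib

open scoped Pointwise

/-- `ℝᵏ` with the Euclidean norm. -/
abbrev Vec (k : ℕ) : Type := EuclideanSpace ℝ (Fin k)

/-- A local decision `(r, x, y)`: reward, auxiliary variables in `ℝⁿ`, impact vector in `ℝᵐ`. -/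
abbrev Dec (n m : ℕ) : Type := ℝ × Vec n × Vec m

namespace Dec

/-- The reward component `r`. -/
def reward {n m : ℕ} (e : Dec n m) : ℝ := e.1

/-- The impact component `y`. -/
def impact {n m : ℕ} (e : Dec n m) : Vec m := e.2.2

end Dec

/-- Assumption A1: the offline problem (maximize the total reward over local decisions in the sets
`Ω t` whose total impact is in `T Ψ`) is feasible, every `Ω t` is compact, and `Ψ = Q + C` with `Q`
compact and convex and `C` a closed convex cone. -/
structure AssumptionA1 {m T : ℕ} {n : Fin T → ℕ} (Ω : ∀ t, Set (Dec (n t) m))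
    (Ψ Q : Set (Vec m)) (C : ProperCone ℝ (Vec m)) : Prop where
  feasible : ∃ e : ∀ t, Dec (n t) m,
    (∀ t, e t ∈ Ω t) ∧ ∑ t, (e t).impact ∈ (T : ℝ) • Ψ
  isCompact_local : ∀ t, IsCompact (Ω t)
  isCompact_Q : IsCompact Q
  convex_Q : Convex ℝ Q
  motzkin : Ψ = Q + (C : Set (Vec m))

/-- Assumption A2 with the constants `dy`, `dr` and `dlow`. -/
structure AssumptionA2 {m T : ℕ} {n : Fin T → ℕ} (Ω : ∀ t, Set (Dec (n t) m))
    (Ψ Q : Set (Vec m)) (dy dr dlow : ℝ) : Prop where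
  impact_bound : ∀ t, ∀ e ∈ Ω t, ∀ v ∈ Q, ∀ i, |e.impact i - v i| ≤ dy
  strongly_feasible : ∀ t, ∃ e ∈ convexHull ℝ (Ω t),
    (∀ e' ∈ Ω t, e'.reward - dr ≤ e.reward) ∧ Metric.closedBall e.impact dlow ⊆ Ψ

/-- The objective values of the feasible points of the relaxation in which every local set
`Ω t` is replaced by its convex hull. -/
def relaxedValues {m T : ℕ} {n : Fin T → ℕ} (Ω : ∀ t, Set (Dec (n t) m))
    (Ψ : Set (Vec m)) : Set ℝ :=
  {z | ∃ e : ∀ t, Dec (n t) m, (∀ t, e t ∈ convexHull ℝ (Ω t)) ∧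
    ∑ t, (e t).impact ∈ (T : ℝ) • Ψ ∧ z = ∑ t, (e t).reward}

/-- The optimal value `z^R` of the relaxation. -/
noncomputable def zR {m T : ℕ} {n : Fin T → ℕ} (Ω : ∀ t, Set (Dec (n t) m))
    (Ψ : Set (Vec m)) : ℝ :=
  sSup (relaxedValues Ω Ψ)

/-- The polar cone `C° = {u | ⟪u, v⟫ ≤ 0 for all v ∈ C}`. -/
def polarCone {m : ℕ} (C : ProperCone ℝ (Vec m)) : Set (Vec m) :=
  {u | ∀ v ∈ C, inner ℝ u v ≤ 0}

/-- The stepsize `min {1/m, 1/√(m t)}` of the step number `t = 1, 2, …`. -/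
noncomputable def stepsize (m t : ℕ) : ℝ :=
  min (1 / (m : ℝ)) (1 / Real.sqrt ((m : ℝ) * (t : ℝ)))

/-- The data generated in `T` steps. The index `t : Fin T` stands for the step number `t + 1`. -/
structure Run (m : ℕ) {T : ℕ} (n : Fin T → ℕ) where
  /-- dual multipliers -/
  p : Fin (T + 1) → Vec m
  /-- implemented local decisions -/
  sol : ∀ t, Dec (n t) m
  /-- maximizers over `Q` -/
  v : Fin T → Vec m

namespace Run

/-- The accumulated reward. -/
def totalReward {m T : ℕ} {n : Fin T → ℕ} (R : Run m n) : ℝ := ∑ t, (R.sol t).reward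

/-- `R` is an execution, on the local sets `Ω t`, of the Fenchel dual-based algorithm with the
stepsizes `stepsize m 1, stepsize m 2, …`. The last two fields say that the next multiplier is the
Euclidean projection of `p - η (v - y)` onto the polar cone of `C`. -/
structure IsExecution {m T : ℕ} {n : Fin T → ℕ} (R : Run m n) (Ω : ∀ t, Set (Dec (n t) m))
    (Q : Set (Vec m)) (C : ProperCone ℝ (Vec m)) : Prop where
  init : R.p 0 = 0
  sol_mem : ∀ t, R.sol t ∈ Ω t
  sol_opt : ∀ t, ∀ e ∈ Ω t,
    e.reward - inner ℝ (R.p t.castSucc) e.impact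
      ≤ (R.sol t).reward - inner ℝ (R.p t.castSucc) (R.sol t).impact
  v_mem : ∀ t, R.v t ∈ Q
  v_opt : ∀ t, ∀ w ∈ Q, inner ℝ (R.p t.castSucc) w ≤ inner ℝ (R.p t.castSucc) (R.v t)
  step_mem : ∀ t : Fin T, R.p t.succ ∈ polarCone C
  step_proj : ∀ t : Fin T, ∀ u ∈ polarCone C,
    dist (R.p t.castSucc - stepsize m (t + 1) • (R.v t - (R.sol t).impact)) (R.p t.succ)
      ≤ dist (R.p t.castSucc - stepsize m (t + 1) • (R.v t - (R.sol t).impact)) u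

/-- The choices made among several maximizers are nonanticipating: what is chosen at a step is
determined by the arrivals up to and including that step. -/
def Nonanticipating {m T : ℕ} {n : Fin T → ℕ}
    (R : ∀ π : Equiv.Perm (Fin T), Run m (fun t => n (π t))) : Prop :=
  ∀ (π π' : Equiv.Perm (Fin T)) (t : Fin T), (∀ s ≤ t, π s = π' s) →
    (⟨π t, (R π).sol t⟩ : (τ : Fin T) × Dec (n τ) m) = ⟨π' t, (R π').sol t⟩ ∧
      (R π).v t = (R π').v t

end Run

/-- The probability of an event under the uniform distribution on the `T!` permutations. -/
noncomputable def permProb {T : ℕ} (A : Set (Equiv.Perm (Fin T))) : ℝ :=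
  ((PMF.uniformOfFintype (Equiv.Perm (Fin T))).toOuterMeasure A).toReal

/-! Fix an optimum `e` of the relaxation with total impact `T y`, `y ∈ Ψ`, and put `w τ = impact (e
τ) - y`, so that `∑ w τ = 0`. Let `g` be the subgradient `v - y` formed from the choices at step
`t`. Optimality of these choices, with `p ∈ C°`, gives: reward at `t` ≥ reward of `e (π t)` - `⟪p, w
(π t)⟫` - `⟪p, g⟫` (`reward_ge`). Summing over `t`, two error sums remain.

Deterministic: the ball around a strongly feasible impact pushes `p` back whenever it is long, so
`‖p‖ ≤ D` with `D` depending only on the constants (`norm_le`); the regret of subgradient descent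
against `0` then bounds `∑ ⟪p, g⟫` by `O(√(mT))` (`sum_inner_grad_le`).

Random: split `w (π t)` into its deviation from the mean of the undrawn elements, plus that mean.
Since `p` depends only on earlier arrivals, the deviations yield martingale differences, handled by
Azuma–Hoeffding. The mean has coordinates `O(√(L / (T - t)))` by Hoeffding without replacement,
where `L = log (T / ρ)`, and these bounds sum to `O(√(T L))` (`permProb_sum_inner_ge_le`). -/

/-- In finite dimension the convex hull of a compact set is compact. -/
theorem IsCompact.convexHull_of_finiteDimensional {E : Type*} [NormedAddCommGroup E]
    [NormedSpace ℝ E] [FiniteDimensional ℝ E] {s : Set E} (hs : IsCompact s) :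
    IsCompact (convexHull ℝ s) := by
  -- Carathéodory: at most `finrank + 1` points suffice, so the hull is a finite union of continuous
  -- images of compact sets.
  have key : convexHull ℝ s = ⋃ k ∈ Finset.range (Module.finrank ℝ E + 2),
      (fun q : (Fin k → ℝ) × (Fin k → E) => ∑ i, q.1 i • q.2 i) ''
        (stdSimplex ℝ (Fin k) ×ˢ Set.univ.pi fun _ => s) := by
    apply Set.Subset.antisymm
    · intro x hx
      obtain ⟨ι, _, z, w, hz, hind, hw, hw1, hx⟩ := eq_pos_convex_span_of_mem_convexHull hx
      have hcard := hind.card_le_finrank_succ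
      have hle := Submodule.finrank_le (vectorSpan ℝ (Set.range z))
      simp only [Set.mem_iUnion]
      refine ⟨Fintype.card ι, Finset.mem_range.2 (by omega), ?_⟩
      let e := (Fintype.equivFin ι).symm
      refine ⟨(fun i => w (e i), fun i => z (e i)), ⟨⟨fun i => (hw _).le, ?_⟩, ?_⟩, ?_⟩
      · rw [← hw1]; exact e.sum_comp w
      · exact fun i _ => hz ⟨_, rfl⟩
      · rw [← hx]; exact e.sum_comp fun i => w i • z i
    · simp only [Set.iUnion_subset_iff]
      rintro k - _ ⟨⟨w, z⟩, ⟨⟨hw, hw1⟩, hz⟩, rfl⟩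
      exact (convex_convexHull ℝ s).sum_mem (fun i _ => hw i) hw1
        fun i _ => subset_convexHull ℝ s (hz i trivial)
  rw [key]
  refine (Finset.range _).isCompact_biUnion fun k _ => IsCompact.image ?_ (by fun_prop)
  exact (isCompact_stdSimplex ℝ (Fin k)).prod (isCompact_univ_pi fun _ => hs)

/-! ### Azuma–Hoeffding for uniformly random permutations -/

section Permutations

open Finset

/-- Sampling without replacement: composing a uniformly random permutation with the
transpositions that fix the first `t` values does not change averages. -/
theorem card_mul_sum_perm_eq {T : ℕ} (t : Fin T) (G : Equiv.Perm (Fin T) → ℝ) :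
    ((Ici t).card : ℝ) * ∑ π, G π = ∑ π, ∑ s ∈ Ici t, G (π * Equiv.swap t s) := by
  rw [sum_comm, ← nsmul_eq_mul, ← sum_const]
  exact sum_congr rfl fun s _ =>
    (Fintype.sum_equiv (Equiv.mulRight (Equiv.swap t s)) _ _ fun _ => rfl).symm

/-- By convexity `exp` lies below its chord over `[-c, c]`; multiplying by `c` includes the case `c
= 0`. -/
theorem Real.mul_exp_le_mul_cosh_add_mul_sinh {x c : ℝ} (h : |x| ≤ c) :
    c * Real.exp x ≤ c * Real.cosh c + x * Real.sinh c := by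
  obtain ⟨h1, h2⟩ := abs_le.1 h
  rcases (abs_nonneg x |>.trans h).eq_or_lt with rfl | hc
  · simp
  have := convexOn_exp.right (Set.mem_univ (-c)) (Set.mem_univ c)
    (show 0 ≤ (c - x) / (2 * c) from div_nonneg (by linarith) (by linarith))
    (show 0 ≤ (c + x) / (2 * c) from div_nonneg (by linarith) (by linarith))
    (by field_simp; ring)
  have hx : ((c - x) / (2 * c)) • (-c) + ((c + x) / (2 * c)) • c = x := by
    simp only [smul_eq_mul]; field_simp; ring
  rw [hx] at this
  rw [Real.cosh_eq, Real.sinh_eq]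
  calc c * Real.exp x ≤ c * _ := mul_le_mul_of_nonneg_left this hc.le
    _ = _ := by simp only [smul_eq_mul]; field_simp; ring

/-- Hoeffding's lemma: summation kills the linear term of the chord bound, and `cosh c ≤ exp (c ^ 2
/ 2)`. -/
theorem sum_exp_le_of_sum_eq_zero {ι : Type*} (A : Finset ι) (x : ι → ℝ) {c : ℝ}
    (hx : ∀ i ∈ A, |x i| ≤ c) (h0 : ∑ i ∈ A, x i = 0) :
    ∑ i ∈ A, Real.exp (x i) ≤ A.card * Real.exp (c ^ 2 / 2) := by
  rcases A.eq_empty_or_nonempty with rfl | ⟨j, hj⟩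
  · simp
  rcases (abs_nonneg (x j) |>.trans (hx j hj)).eq_or_lt with rfl | hc
  · rw [sum_congr rfl fun i hi => by rw [abs_nonpos_iff.1 (hx i hi)]]
    simp
  have : c * ∑ i ∈ A, Real.exp (x i) ≤ c * (A.card * Real.cosh c) := by
    rw [mul_sum]
    refine (sum_le_sum fun i hi => Real.mul_exp_le_mul_cosh_add_mul_sinh (hx i hi)).trans_eq ?_
    rw [sum_add_distrib, ← sum_mul _ x, h0, sum_const, nsmul_eq_mul]; ring
  exact (le_of_mul_le_mul_left this hc).trans
    (mul_le_mul_of_nonneg_left (Real.cosh_le_exp_half_sq c) (Nat.cast_nonneg _))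

/-- Averaging over the swaps of `t` with later positions plays the role of conditioning on the past;
`F` is constant under them and factors out. -/
theorem sum_perm_mul_exp_le {T : ℕ} (t : Fin T) (F X : Equiv.Perm (Fin T) → ℝ) {c : ℝ}
    (hF : ∀ π, 0 ≤ F π) (hFt : ∀ π, ∀ s ≥ t, F (π * Equiv.swap t s) = F π)
    (hX : ∀ π, |X π| ≤ c) (hX0 : ∀ π, ∑ s ∈ Ici t, X (π * Equiv.swap t s) = 0) :
    ∑ π, F π * Real.exp (X π) ≤ Real.exp (c ^ 2 / 2) * ∑ π, F π := by
  have hk : (0 : ℝ) < (Ici t).card := by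
    exact_mod_cast card_pos.2 ⟨t, mem_Ici.2 le_rfl⟩
  refine le_of_mul_le_mul_left ?_ hk
  rw [card_mul_sum_perm_eq, mul_sum, mul_sum]
  refine sum_le_sum fun π _ => ?_
  calc ∑ s ∈ Ici t, F (π * Equiv.swap t s) * Real.exp (X (π * Equiv.swap t s))
      = F π * ∑ s ∈ Ici t, Real.exp (X (π * Equiv.swap t s)) := by
        rw [mul_sum]
        exact sum_congr rfl fun s hs => by rw [hFt π s (mem_Ici.1 hs)]
    _ ≤ F π * ((Ici t).card * Real.exp (c ^ 2 / 2)) :=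
        mul_le_mul_of_nonneg_left (sum_exp_le_of_sum_eq_zero _ _ (fun _ _ => hX _) (hX0 π)) (hF π)
    _ = _ := by ring

/-- `X 0, X 1, …` is a martingale difference sequence for the filtration generated by
`π 0, π 1, …`, where `π` is a uniformly random permutation. -/
structure IsPermMartingaleDiff {T : ℕ} (X : Fin T → Equiv.Perm (Fin T) → ℝ) : Prop where
  adapted : ∀ s t u : Fin T, s < t → t ≤ u → ∀ π, X s (π * Equiv.swap t u) = X s π
  mean_zero : ∀ t π, ∑ s ∈ Ici t, X t (π * Equiv.swap t s) = 0

theorem IsPermMartingaleDiff.const_mul {T : ℕ} {X : Fin T → Equiv.Perm (Fin T) → ℝ}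
    (h : IsPermMartingaleDiff X) (θ : ℝ) : IsPermMartingaleDiff fun t π => θ * X t π where
  adapted s t u hs hu π := by rw [h.adapted s t u hs hu]
  mean_zero t π := by rw [← mul_sum, h.mean_zero, mul_zero]

theorem IsPermMartingaleDiff.sum_exp_le {T : ℕ} {X : Fin T → Equiv.Perm (Fin T) → ℝ}
    (h : IsPermMartingaleDiff X) {c : Fin T → ℝ} (hX : ∀ t π, |X t π| ≤ c t) :
    ∑ π, Real.exp (∑ t, X t π) ≤ (T.factorial : ℝ) * Real.exp ((∑ t, c t ^ 2) / 2) := by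
  have key : ∀ n : ℕ, n ≤ T → ∑ π, Real.exp (∑ t with t.val < n, X t π)
      ≤ (T.factorial : ℝ) * Real.exp ((∑ t : Fin T with t.val < n, c t ^ 2) / 2) := by
    intro n
    induction n with
    | zero => intro _; simp [Fintype.card_perm]
    | succ n ih =>
      intro hn
      let t : Fin T := ⟨n, hn⟩
      have hins : (univ.filter fun s : Fin T => s.val < n + 1)
          = insert t (univ.filter fun s : Fin T => s.val < n) := by
        ext s; simp [t, Fin.ext_iff]; omega
      have hnot : t ∉ univ.filter fun s : Fin T => s.val < n := by simp [t]
      simp only [hins, sum_insert hnot]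
      have := sum_perm_mul_exp_le t (fun π => Real.exp (∑ s with s.val < n, X s π)) (X t)
        (fun π => (Real.exp_pos _).le) (fun π s hs => by
          congr 1
          refine sum_congr rfl fun r hr => h.adapted r t s ?_ hs π
          simpa [t, Fin.lt_def] using hr) (hX t) (h.mean_zero t)
      calc ∑ π, Real.exp (X t π + ∑ s with s.val < n, X s π)
          = ∑ π, Real.exp (∑ s with s.val < n, X s π) * Real.exp (X t π) :=
            sum_congr rfl fun π _ => by rw [← Real.exp_add, add_comm]
        _ ≤ _ := this
        _ ≤ _ := mul_le_mul_of_nonneg_left (ih (by omega)) (Real.exp_pos _).le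
        _ = _ := by rw [add_div, Real.exp_add]; ring
  simpa using key T le_rfl

theorem permProb_eq_card_div {T : ℕ} (A : Set (Equiv.Perm (Fin T))) [DecidablePred (· ∈ A)] :
    permProb A = ((univ.filter (· ∈ A)).card : ℝ) / T.factorial := by
  classical
  rw [permProb, PMF.toOuterMeasure_uniformOfFintype_apply, Fintype.card_perm, Fintype.card_fin,
    ENNReal.toReal_div, ENNReal.toReal_natCast, ENNReal.toReal_natCast, Fintype.card_subtype]

/-- The Azuma–Hoeffding inequality for a uniformly random permutation. -/
theorem IsPermMartingaleDiff.permProb_sum_ge_le {T : ℕ} {X : Fin T → Equiv.Perm (Fin T) → ℝ}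
    (h : IsPermMartingaleDiff X) {c : Fin T → ℝ} (hX : ∀ t π, |X t π| ≤ c t) {V ε : ℝ}
    (hV : 0 < V) (hc : ∑ t, c t ^ 2 ≤ V) (hε : 0 ≤ ε) :
    permProb {π | ε ≤ ∑ t, X t π} ≤ Real.exp (-ε ^ 2 / (2 * V)) := by
  classical
  rw [permProb_eq_card_div, div_le_iff₀ (by exact_mod_cast T.factorial_pos)]
  -- Chernoff bound; this `θ` minimizes `θ ^ 2 * V / 2 - θ * ε`.
  set θ := ε / V with hθ
  have hθ0 : 0 ≤ θ := div_nonneg hε hV.le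
  have h1 := (h.const_mul θ).sum_exp_le (c := fun t => θ * c t) fun t π => by
    rw [abs_mul, abs_of_nonneg hθ0]; exact mul_le_mul_of_nonneg_left (hX t π) hθ0
  have h2 : ((univ.filter (· ∈ {π | ε ≤ ∑ t, X t π})).card : ℝ) * Real.exp (θ * ε)
      ≤ ∑ π, Real.exp (∑ t, θ * X t π) := by
    rw [← nsmul_eq_mul, ← sum_const]
    refine (sum_le_sum fun π hπ => ?_).trans
      (sum_le_sum_of_subset_of_nonneg (filter_subset _ _) fun π _ _ => (Real.exp_pos _).le)
    rw [← mul_sum]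
    exact Real.exp_le_exp.2 (mul_le_mul_of_nonneg_left (by simpa using hπ) hθ0)
  have h3 : (∑ t, (θ * c t) ^ 2) / 2 ≤ θ ^ 2 * V / 2 := by
    simp_rw [mul_pow, ← mul_sum]
    gcongr
  have h4 : Real.exp (-ε ^ 2 / (2 * V)) = Real.exp (θ ^ 2 * V / 2) / Real.exp (θ * ε) := by
    rw [← Real.exp_sub, hθ]; congr 1; field_simp; ring
  rw [h4, div_mul_eq_mul_div, le_div_iff₀ (Real.exp_pos _)]
  refine h2.trans (h1.trans ?_)
  rw [mul_comm]
  gcongr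

theorem permProb_mono {T : ℕ} {A B : Set (Equiv.Perm (Fin T))} (h : A ⊆ B) :
    permProb A ≤ permProb B := by
  classical
  rw [permProb_eq_card_div, permProb_eq_card_div]
  gcongr

theorem permProb_union_le {T : ℕ} (A B : Set (Equiv.Perm (Fin T))) :
    permProb (A ∪ B) ≤ permProb A + permProb B := by
  classical
  rw [permProb_eq_card_div, permProb_eq_card_div, permProb_eq_card_div, ← add_div]
  gcongr
  norm_cast
  refine le_trans (card_le_card fun π hπ => ?_) (card_union_le _ _)
  simpa using hπ

theorem permProb_biUnion_le {T : ℕ} {ι : Type*} (s : Finset ι)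
    (A : ι → Set (Equiv.Perm (Fin T))) :
    permProb (⋃ i ∈ s, A i) ≤ ∑ i ∈ s, permProb (A i) := by
  classical
  induction s using Finset.induction_on with
  | empty => simp [permProb]
  | insert a s ha ih =>
    rw [sum_insert ha, Finset.set_biUnion_insert]
    exact (permProb_union_le _ _).trans (by gcongr)

theorem permProb_compl {T : ℕ} (A : Set (Equiv.Perm (Fin T))) :
    permProb Aᶜ = 1 - permProb A := by
  classical
  have hT : (T.factorial : ℝ) ≠ 0 := by exact_mod_cast T.factorial_ne_zero
  rw [permProb_eq_card_div, permProb_eq_card_div, eq_sub_iff_add_eq, ← add_div, div_eq_one_iff_eq hT]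
  norm_cast
  have := card_filter_add_card_filter_not (s := univ) (fun π : Equiv.Perm (Fin T) => π ∈ A)
  simp only [card_univ, Fintype.card_perm, Fintype.card_fin] at this
  rw [← this, add_comm]
  simp

end Permutations

/-! ### Hoeffding's inequality without replacement -/

section SamplingWithoutReplacement

open Finset

variable {T : ℕ} {E : Type*} [AddCommGroup E] [Module ℝ E]

/-- The mean of the values of `a` at the elements `π t, π (t + 1), …` that have not been drawn
before step `t`. -/
noncomputable def remainingMean (a : Fin T → E) (π : Equiv.Perm (Fin T)) (t : ℕ) : E :=
  ((T : ℝ) - t)⁻¹ • ∑ s with t ≤ s.val, a (π s)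

theorem remainingMean_mul_swap (a : Fin T → E) (π : Equiv.Perm (Fin T)) {t : ℕ} {u v : Fin T}
    (hu : t ≤ u.val) (hv : t ≤ v.val) :
    remainingMean a (π * Equiv.swap u v) t = remainingMean a π t := by
  rw [remainingMean, remainingMean]
  congr 1
  refine sum_equiv (Equiv.swap u v) (fun s => ?_) fun _ _ => rfl
  simp only [mem_filter_univ]
  rw [Equiv.swap_apply_def]
  split_ifs with h1 h2
  · subst h1; exact iff_of_true hu hv
  · subst h2; exact iff_of_true hv hu
  · rfl

theorem sum_filter_le_eq_smul_remainingMean (a : Fin T → E) (π : Equiv.Perm (Fin T)) {t : ℕ}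
    (ht : t < T) :
    ∑ s with t ≤ s.val, a (π s) = ((T : ℝ) - t) • remainingMean a π t := by
  have : (T : ℝ) - t ≠ 0 := (sub_pos.2 (by exact_mod_cast ht)).ne'
  rw [remainingMean, smul_smul, mul_inv_cancel₀ this, one_smul]

theorem sum_filter_le_eq_add {M : Type*} [AddCommMonoid M] (f : Fin T → M) (t : Fin T) :
    ∑ s with t.val ≤ s.val, f s = f t + ∑ s with t.val + 1 ≤ s.val, f s := by
  have : (univ.filter fun s : Fin T => t.val ≤ s.val)
      = insert t (univ.filter fun s : Fin T => t.val + 1 ≤ s.val) := by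
    ext s; simp [Fin.ext_iff]; omega
  rw [this, sum_insert (by simp)]

theorem filter_le_val_eq_Ici (t : Fin T) :
    (univ.filter fun s : Fin T => t.val ≤ s.val) = Ici t := by
  ext s; rw [mem_filter_univ, mem_Ici, Fin.le_def]

theorem sum_Ici_mul_swap (a : Fin T → E) (π : Equiv.Perm (Fin T)) (t : Fin T) :
    ∑ s ∈ Ici t, a ((π * Equiv.swap t s) t) = ((T : ℝ) - t) • remainingMean a π t := by
  rw [← sum_filter_le_eq_smul_remainingMean a π t.2, filter_le_val_eq_Ici]
  simp

theorem card_Ici_cast (t : Fin T) : ((Ici t).card : ℝ) = (T : ℝ) - t := by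
  rw [Fin.card_Ici, Nat.cast_sub t.2.le]

theorem remainingMean_succ_sub (a : Fin T → E) (π : Equiv.Perm (Fin T)) (t : Fin T)
    (ht : t.val + 1 < T) :
    remainingMean a π (t.val + 1) - remainingMean a π t
      = ((T : ℝ) - t - 1)⁻¹ • (remainingMean a π t - a (π t)) := by
  have h := sum_filter_le_eq_add (fun s => a (π s)) t
  rw [sum_filter_le_eq_smul_remainingMean a π t.2, sum_filter_le_eq_smul_remainingMean a π ht] at h
  have h0 : (T : ℝ) - t - 1 ≠ 0 := by
    have : (t.val : ℝ) + 1 < T := by exact_mod_cast ht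
    linarith
  have h' : remainingMean a π t - a (π t)
      = ((T : ℝ) - t - 1) • (remainingMean a π (t.val + 1) - remainingMean a π t) := by
    have h2 : ((T : ℝ) - t - 1) • remainingMean a π (t.val + 1)
        = ((T : ℝ) - t) • remainingMean a π t - a (π t) := by
      rw [h]; push_cast; rw [add_sub_cancel_left]; congr 1; ring
    rw [smul_sub, h2, sub_smul ((T : ℝ) - t) 1, one_smul]; abel
  rw [h', smul_smul, inv_mul_cancel₀ h0, one_smul]

theorem abs_remainingMean_le (a : Fin T → ℝ) {b : ℝ} (ha : ∀ τ, |a τ| ≤ b)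
    (π : Equiv.Perm (Fin T)) (t : Fin T) : |remainingMean a π t| ≤ b := by
  have h0 : (0 : ℝ) < (T : ℝ) - t := sub_pos.2 (by exact_mod_cast t.2)
  rw [remainingMean, smul_eq_mul, abs_mul, abs_of_pos (inv_pos.2 h0), inv_mul_le_iff₀ h0,
    filter_le_val_eq_Ici, ← card_Ici_cast]
  refine (abs_sum_le_sum_abs _ _).trans ?_
  rw [← nsmul_eq_mul, ← sum_const]
  exact sum_le_sum fun _ _ => ha _

theorem sum_inv_sq_le (T : ℕ) {t : ℕ} (ht : t < T) :
    ∑ s ∈ range t, (((T : ℝ) - s - 1)⁻¹) ^ 2 ≤ 2 / ((T : ℝ) - t) := by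
  induction t with
  | zero => simp; positivity
  | succ t ih =>
    rw [sum_range_succ]
    refine (add_le_add_left (ih (by omega)) _).trans ?_
    have h : (t : ℝ) + 2 ≤ T := by exact_mod_cast ht
    push_cast
    -- The increment is `1 / k ^ 2 ≤ 2 / k - 2 / (k + 1)`, valid for `k ≥ 1`.
    obtain ⟨k, hk, hT⟩ : ∃ k : ℝ, 1 ≤ k ∧ (T : ℝ) = t + 1 + k := ⟨T - t - 1, by linarith, by ring⟩
    rw [hT, show (t : ℝ) + 1 + k - t = k + 1 by ring, show k + 1 - 1 = k by ring,
      show (t : ℝ) + 1 + k - (t + 1) = k by ring]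
    rw [inv_pow, ← one_div, div_add_div _ _ (by positivity) (by positivity),
      div_le_div_iff₀ (by positivity) (by positivity)]
    nlinarith [mul_nonneg (sub_nonneg.2 hk) (sq_nonneg k)]

/-- The increments of the mean of the remaining elements before step `t`. -/
noncomputable def meanIncrement (a : Fin T → ℝ) (t : ℕ) (s : Fin T) (π : Equiv.Perm (Fin T)) : ℝ :=
  if s.val < t then remainingMean a π (s.val + 1) - remainingMean a π s else 0

/-- Each increment is a multiple of (current mean - drawn value), which averages to zero over the
possible draws. The cutoff `t < T` keeps `T - s - 1` nonzero. -/
theorem isPermMartingaleDiff_meanIncrement (a : Fin T → ℝ) {t : ℕ} (ht : t < T) :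
    IsPermMartingaleDiff (meanIncrement a t) where
  adapted s u v hs hu π := by
    have hs' : s.val < u.val := hs
    have hu' : u.val ≤ v.val := hu
    simp only [meanIncrement]
    rw [remainingMean_mul_swap a π (by omega) (by omega),
      remainingMean_mul_swap a π (by omega) (by omega)]
  mean_zero s π := by
    by_cases h : s.val < t
    · simp only [meanIncrement, if_pos h]
      rw [sum_congr rfl fun u hu => by
        rw [remainingMean_succ_sub a _ s (by omega),
          remainingMean_mul_swap a π le_rfl (Fin.le_def.1 (mem_Ici.1 hu))],
        ← smul_sum, sum_sub_distrib, sum_Ici_mul_swap, sum_const, ← Nat.cast_smul_eq_nsmul ℝ,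
        card_Ici_cast, sub_self, smul_zero]
    · simp [meanIncrement, h]

theorem sum_meanIncrement (a : Fin T → ℝ) {t : ℕ} (ht : t < T) (π : Equiv.Perm (Fin T)) :
    ∑ s, meanIncrement a t s π = remainingMean a π t - remainingMean a π 0 := by
  simp only [meanIncrement]
  rw [Fin.sum_univ_eq_sum_range
    (fun s => if s < t then remainingMean a π (s + 1) - remainingMean a π s else 0) T,
    ← sum_filter, ← sum_range_sub]
  congr 1
  ext s; simp; omega

/-- Hoeffding's inequality for sampling without replacement. -/
theorem permProb_remainingMean_ge_le (a : Fin T → ℝ) {b : ℝ} (hb : 0 < b) (ha : ∀ τ, |a τ| ≤ b)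
    (ha0 : ∑ τ, a τ = 0) (t : Fin T) {ε : ℝ} (hε : 0 ≤ ε) :
    permProb {π | ε ≤ remainingMean a π t}
      ≤ Real.exp (-ε ^ 2 * ((T : ℝ) - t) / (16 * b ^ 2)) := by
  have hk : (0 : ℝ) < (T : ℝ) - t := sub_pos.2 (by exact_mod_cast t.2)
  have h0 : ∀ π, remainingMean a π 0 = 0 := fun π => by
    simp [remainingMean, Equiv.sum_comp π a, ha0]
  have h := (isPermMartingaleDiff_meanIncrement a t.2).permProb_sum_ge_le
    (c := fun s : Fin T => if s.val < t.val then 2 * b * ((T : ℝ) - s - 1)⁻¹ else 0)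
    -- Increments are at most `2 * b / (T - s - 1)`; `sum_inv_sq_le` bounds the sum of their
    -- squares.
    (V := 8 * b ^ 2 / ((T : ℝ) - t)) (ε := ε) ?_ (by positivity) ?_ hε
  · simp only [sum_meanIncrement a t.2, h0, sub_zero] at h
    refine h.trans_eq ?_
    congr 1; field_simp; ring
  · intro s π
    simp only [meanIncrement]
    split_ifs with hs
    · have h1 : (0 : ℝ) < (T : ℝ) - s - 1 := by
        have : (s.val : ℝ) + 1 < T := by exact_mod_cast (by omega : s.val + 1 < T)
        linarith
      rw [remainingMean_succ_sub a π s (by omega), smul_eq_mul, abs_mul,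
        abs_of_pos (inv_pos.2 h1), mul_comm]
      gcongr
      refine (abs_sub _ _).trans ?_
      linarith [abs_remainingMean_le a ha π s, ha (π s)]
    · simp
  · rw [Fin.sum_univ_eq_sum_range
      (fun s : ℕ => (if s < t.val then 2 * b * ((T : ℝ) - s - 1)⁻¹ else 0) ^ 2) T]
    have : ∀ s : ℕ, (if s < t.val then 2 * b * ((T : ℝ) - s - 1)⁻¹ else 0) ^ 2
        = if s < t.val then 4 * b ^ 2 * (((T : ℝ) - s - 1)⁻¹) ^ 2 else 0 := by
      intro s; split_ifs <;> ring
    simp only [this]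
    rw [← sum_filter, ← mul_sum]
    have hr : (range T).filter (· < t.val) = range t.val := by ext s; simp; omega
    rw [hr]
    calc _ ≤ 4 * b ^ 2 * (2 / ((T : ℝ) - t)) := by gcongr; exact sum_inv_sq_le T t.2
      _ = _ := by ring

end SamplingWithoutReplacement

/-! ### Projections, polar cones and linear functionals of decisions -/

open scoped RealInnerProductSpace in
/-- The variational inequality of the projection onto a convex set. -/
theorem Convex.inner_sub_le_zero_of_forall_dist_le {E : Type*} [NormedAddCommGroup E]
    [InnerProductSpace ℝ E] {K : Set E} (hK : Convex ℝ K) {x q : E} (hq : q ∈ K)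
    (h : ∀ u ∈ K, dist x q ≤ dist x u) : ∀ w ∈ K, ⟪x - q, w - q⟫ ≤ 0 := by
  refine (norm_eq_iInf_iff_real_inner_le_zero hK hq).1 (le_antisymm ?_ ?_)
  · have : Nonempty K := ⟨⟨q, hq⟩⟩
    exact le_ciInf fun u => by simpa [dist_eq_norm] using h u u.2
  · exact ciInf_le ⟨0, by rintro _ ⟨u, rfl⟩; exact norm_nonneg _⟩ (⟨q, hq⟩ : K)

theorem Convex.eq_of_forall_dist_le {E : Type*} [NormedAddCommGroup E]
    [InnerProductSpace ℝ E] {K : Set E} (hK : Convex ℝ K) {x q q' : E} (hq : q ∈ K)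
    (hq' : q' ∈ K) (h : ∀ u ∈ K, dist x q ≤ dist x u) (h' : ∀ u ∈ K, dist x q' ≤ dist x u) :
    q = q' := by
  have h1 := hK.inner_sub_le_zero_of_forall_dist_le hq h q' hq'
  have h2 := hK.inner_sub_le_zero_of_forall_dist_le hq' h' q hq
  have : inner ℝ (q - q') (q - q') = inner ℝ (x - q) (q' - q) + inner ℝ (x - q') (q - q') := by
    rw [← neg_sub q q', inner_neg_right, ← sub_eq_neg_add, ← inner_sub_left]
    congr 1; abel
  rw [real_inner_self_eq_norm_sq] at this
  exact sub_eq_zero.1 (norm_eq_zero.1 (pow_eq_zero_iff two_ne_zero |>.1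
    (le_antisymm (this ▸ add_nonpos h1 h2) (sq_nonneg _))))

theorem Convex.norm_le_of_forall_dist_le {E : Type*} [NormedAddCommGroup E]
    [InnerProductSpace ℝ E] {K : Set E} (hK : Convex ℝ K) {x q : E} (hq : q ∈ K)
    (h0 : (0 : E) ∈ K) (h : ∀ u ∈ K, dist x q ≤ dist x u) : ‖q‖ ≤ ‖x‖ := by
  have h1 := hK.inner_sub_le_zero_of_forall_dist_le hq h 0 h0
  rw [zero_sub, inner_neg_right, inner_sub_left, real_inner_self_eq_norm_sq] at h1
  have h2 := real_inner_le_norm x q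
  rcases (norm_nonneg q).eq_or_lt with h3 | h3
  · rw [← h3]; exact norm_nonneg x
  · nlinarith

theorem EuclideanSpace.norm_le_sqrt_mul {m : ℕ} {x : Vec m} {b : ℝ} (hb : 0 ≤ b)
    (h : ∀ i, |x i| ≤ b) : ‖x‖ ≤ Real.sqrt m * b := by
  rw [EuclideanSpace.norm_eq, ← Real.sqrt_sq hb, ← Real.sqrt_mul (Nat.cast_nonneg m)]
  refine Real.sqrt_le_sqrt ?_
  refine (Finset.sum_le_sum fun i _ => ?_).trans_eq (b := ∑ _i : Fin m, b ^ 2) (by simp)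
  rw [Real.norm_eq_abs]
  exact pow_le_pow_left₀ (abs_nonneg _) (h i) 2

theorem convex_polarCone {m : ℕ} (C : ProperCone ℝ (Vec m)) : Convex ℝ (polarCone C) := by
  intro x hx y hy a b ha hb _ v hv
  rw [inner_add_left, inner_smul_left, inner_smul_left]
  exact add_nonpos (mul_nonpos_of_nonneg_of_nonpos ha (hx v hv))
    (mul_nonpos_of_nonneg_of_nonpos hb (hy v hv))

theorem zero_mem_polarCone {m : ℕ} (C : ProperCone ℝ (Vec m)) : (0 : Vec m) ∈ polarCone C :=
  fun v _ => by simp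

/-- In a direction of `C°`, the cone part cannot raise the support function of `Q`. -/
theorem inner_le_of_mem_add_cone {m : ℕ} {Q : Set (Vec m)} {C : ProperCone ℝ (Vec m)}
    {p v y : Vec m} (hp : p ∈ polarCone C) (hv : ∀ w ∈ Q, inner ℝ p w ≤ inner ℝ p v)
    (hy : y ∈ Q + (C : Set (Vec m))) : inner ℝ p y ≤ inner ℝ p v := by
  obtain ⟨w, hw, c, hc, rfl⟩ := hy
  rw [inner_add_right]
  linarith [hv w hw, hp c hc]

namespace Dec

variable {n m : ℕ}

theorem isLinearMap_reward : IsLinearMap ℝ (reward : Dec n m → ℝ) :=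
  ⟨fun _ _ => rfl, fun _ _ => rfl⟩

theorem isLinearMap_impact : IsLinearMap ℝ (impact : Dec n m → Vec m) :=
  ⟨fun _ _ => rfl, fun _ _ => rfl⟩

theorem isLinearMap_reward_sub_inner (p : Vec m) :
    IsLinearMap ℝ fun e : Dec n m => e.reward - inner ℝ p e.impact where
  map_add e f := by
    rw [isLinearMap_reward.map_add, isLinearMap_impact.map_add, inner_add_right]; ring
  map_smul c e := by
    rw [isLinearMap_reward.map_smul, isLinearMap_impact.map_smul, inner_smul_right]
    simp only [smul_eq_mul]; ring

theorem continuous_impact : Continuous (impact : Dec n m → Vec m) :=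
  continuous_snd.comp continuous_snd

theorem continuous_reward : Continuous (reward : Dec n m → ℝ) := continuous_fst

theorem reward_sub_inner_le_of_mem_convexHull {S : Set (Dec n m)} {p : Vec m} {c : ℝ}
    (h : ∀ e ∈ S, e.reward - inner ℝ p e.impact ≤ c) {e : Dec n m} (he : e ∈ convexHull ℝ S) :
    e.reward - inner ℝ p e.impact ≤ c :=
  convexHull_min h (convex_halfSpace_le (isLinearMap_reward_sub_inner p) c) he

theorem abs_impact_sub_le_of_mem_convexHull {S : Set (Dec n m)} {i : Fin m} {c d : ℝ}
    (h : ∀ e ∈ S, |e.impact i - c| ≤ d) {e : Dec n m} (he : e ∈ convexHull ℝ S) :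
    |e.impact i - c| ≤ d := by
  have hlin : IsLinearMap ℝ fun e : Dec n m => e.impact i := ⟨fun _ _ => rfl, fun _ _ => rfl⟩
  have h1 := convexHull_min (fun e he => by
      show e.impact i ≤ c + d
      linarith [(abs_le.1 (h e he)).2]) (convex_halfSpace_le hlin (c + d)) he
  have h2 := convexHull_min (fun e he => by
      show c - d ≤ e.impact i
      linarith [(abs_le.1 (h e he)).1]) (convex_halfSpace_ge hlin (c - d)) he
  simp only [Set.mem_ofPred_eq] at h1 h2
  exact abs_le.2 ⟨by linarith, by linarith⟩

end Dec

/-! ### Stepsize estimates -/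

theorem stepsize_pos {m t : ℕ} (hm : 0 < m) (ht : 0 < t) : 0 < stepsize m t := by
  have : (0 : ℝ) < m := by exact_mod_cast hm
  have : (0 : ℝ) < t := by exact_mod_cast ht
  unfold stepsize; positivity

theorem stepsize_anti {m s t : ℕ} (hm : 0 < m) (hs : 0 < s) (hst : s ≤ t) :
    stepsize m t ≤ stepsize m s := by
  have : (0 : ℝ) < m := by exact_mod_cast hm
  have : (0 : ℝ) < s := by exact_mod_cast hs
  unfold stepsize
  gcongr

theorem sum_inv_sqrt_le (T : ℕ) :
    ∑ k ∈ Finset.range T, 1 / Real.sqrt ((k : ℝ) + 1) ≤ 2 * Real.sqrt T := by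
  induction T with
  | zero => simp
  | succ T ih =>
    rw [Finset.sum_range_succ]
    have h1 : 0 < Real.sqrt ((T : ℝ) + 1) := Real.sqrt_pos.2 (by positivity)
    have h2 := Real.sq_sqrt (show (0 : ℝ) ≤ (T : ℝ) + 1 by positivity)
    have h3 := Real.sq_sqrt (Nat.cast_nonneg (α := ℝ) T)
    have h4 := Real.sqrt_nonneg (T : ℝ)
    have : 1 / Real.sqrt ((T : ℝ) + 1) ≤ 2 * (Real.sqrt ((T : ℝ) + 1) - Real.sqrt T) := by
      rw [div_le_iff₀ h1]
      nlinarith [sq_nonneg (Real.sqrt ((T : ℝ) + 1) - Real.sqrt T)]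
    push_cast
    linarith

theorem sum_inv_sqrt_sub_le (T : ℕ) :
    ∑ t : Fin T, 1 / Real.sqrt ((T : ℝ) - t) ≤ 2 * Real.sqrt T := by
  refine le_trans (le_of_eq ?_) (sum_inv_sqrt_le T)
  rw [Fin.sum_univ_eq_sum_range (fun t : ℕ => 1 / Real.sqrt ((T : ℝ) - t)) T,
    ← Finset.sum_range_reflect]
  refine Finset.sum_congr rfl fun k hk => ?_
  rw [Finset.mem_range] at hk
  rw [Nat.cast_sub (by omega), Nat.cast_sub (by omega)]
  congr 2; push_cast; ring

theorem sum_stepsize_le {m : ℕ} (hm : 0 < m) (T : ℕ) :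
    ∑ t : Fin T, (m : ℝ) * stepsize m (t + 1) ≤ 2 * Real.sqrt (m * T) := by
  have hm' : (0 : ℝ) < m := by exact_mod_cast hm
  rw [Fin.sum_univ_eq_sum_range (fun t : ℕ => (m : ℝ) * stepsize m (t + 1)) T]
  calc ∑ t ∈ Finset.range T, (m : ℝ) * stepsize m (t + 1)
      ≤ ∑ t ∈ Finset.range T, Real.sqrt m * (1 / Real.sqrt ((t : ℝ) + 1)) := by
        refine Finset.sum_le_sum fun t _ => ?_
        have h1 : stepsize m (t + 1) ≤ 1 / Real.sqrt ((m : ℝ) * ((t + 1 : ℕ) : ℝ)) :=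
          min_le_right _ _
        refine (mul_le_mul_of_nonneg_left h1 hm'.le).trans_eq ?_
        rw [Real.sqrt_mul hm'.le]
        have h2 : Real.sqrt ((t : ℝ) + 1) ≠ 0 := (Real.sqrt_pos.2 (by positivity)).ne'
        have h3 : Real.sqrt (m : ℝ) ≠ 0 := (Real.sqrt_pos.2 hm').ne'
        push_cast
        field_simp
        rw [Real.sq_sqrt hm'.le]
    _ ≤ Real.sqrt m * (2 * Real.sqrt T) := by
        rw [← Finset.mul_sum]; gcongr; exact sum_inv_sqrt_le T
    _ = _ := by rw [Real.sqrt_mul hm'.le]; ring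

theorem inv_stepsize_le {m T : ℕ} (hm : 0 < m) (hmT : m ≤ T) :
    (stepsize m (T + 1))⁻¹ ≤ 2 * Real.sqrt (m * T) := by
  have hm' : (0 : ℝ) < m := by exact_mod_cast hm
  have hT' : (m : ℝ) ≤ T := by exact_mod_cast hmT
  have h1T : (1 : ℝ) ≤ T := by exact_mod_cast hm.trans_le hmT
  have hs : 0 < Real.sqrt (m * T) := Real.sqrt_pos.2 (by positivity)
  rw [inv_le_comm₀ (stepsize_pos hm T.succ_pos) (by positivity), stepsize, ← one_div]
  refine le_min (one_div_le_one_div_of_le hm' ?_) (one_div_le_one_div_of_le ?_ ?_)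
  · have : (m : ℝ) ≤ Real.sqrt (m * T) := Real.le_sqrt_of_sq_le (by nlinarith)
    linarith
  · exact Real.sqrt_pos.2 (by positivity)
  · rw [Real.sqrt_le_left (by positivity), mul_pow, Real.sq_sqrt (by positivity)]
    push_cast; nlinarith

/-- Abel summation. Keeping `B - N (Fin.last T)` on the right lets the induction absorb each
increase of `a`. -/
theorem sum_mul_sub_succ_le {T : ℕ} {a : ℕ → ℝ} (ha : Monotone a) (ha0 : 0 ≤ a 0)
    (N : Fin (T + 1) → ℝ) {B : ℝ} (hN : ∀ t, N t ≤ B) :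
    ∑ t : Fin T, a t * (N t.castSucc - N t.succ) ≤ a T * (B - N (Fin.last T)) := by
  induction T with
  | zero => simpa using mul_nonneg ha0 (sub_nonneg.2 (hN _))
  | succ T ih =>
    rw [Fin.sum_univ_castSucc]
    have h1 := ih (fun t => N t.castSucc) fun t => hN _
    have h2 := mul_le_mul_of_nonneg_right (ha T.le_succ) (sub_nonneg.2 (hN (Fin.last (T + 1))))
    simp only [Fin.val_castSucc, Fin.val_last, Fin.succ_castSucc, Fin.succ_last,
      Nat.succ_eq_add_one] at h1 h2 ⊢
    linarith

/-! ### Deterministic analysis of one run -/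

namespace Run

variable {m T : ℕ} {n : Fin T → ℕ} {R : Run m n} {Ω : ∀ t, Set (Dec (n t) m)}
  {Ψ Q : Set (Vec m)} {C : ProperCone ℝ (Vec m)} {dy dr dlow : ℝ}

/-- The subgradient used at step `t`. -/
def grad (R : Run m n) (t : Fin T) : Vec m := R.v t - (R.sol t).impact

theorem IsExecution.mem_polarCone (h : R.IsExecution Ω Q C) (t : Fin (T + 1)) :
    R.p t ∈ polarCone C := by
  cases t using Fin.cases with
  | zero => rw [h.init]; exact zero_mem_polarCone C
  | succ t => exact h.step_mem t

theorem IsExecution.norm_succ_le (h : R.IsExecution Ω Q C) (t : Fin T) :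
    ‖R.p t.succ‖ ≤ ‖R.p t.castSucc - stepsize m (t + 1) • R.grad t‖ :=
  (convex_polarCone C).norm_le_of_forall_dist_le (h.step_mem t) (zero_mem_polarCone C)
    (h.step_proj t)

theorem IsExecution.norm_grad_le (h : R.IsExecution Ω Q C)
    (hA : AssumptionA2 Ω Ψ Q dy dr dlow) (hdy : 0 ≤ dy) (t : Fin T) :
    ‖R.grad t‖ ≤ Real.sqrt m * dy := by
  refine EuclideanSpace.norm_le_sqrt_mul hdy fun i => ?_
  rw [grad, PiLp.sub_apply, abs_sub_comm]
  exact hA.impact_bound t _ (h.sol_mem t) _ (h.v_mem t) i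

theorem IsExecution.norm_sq_succ_le (h : R.IsExecution Ω Q C)
    (hA : AssumptionA2 Ω Ψ Q dy dr dlow) (hdy : 0 ≤ dy) (t : Fin T) :
    ‖R.p t.succ‖ ^ 2 ≤ ‖R.p t.castSucc‖ ^ 2
      - 2 * stepsize m (t + 1) * inner ℝ (R.p t.castSucc) (R.grad t)
      + stepsize m (t + 1) ^ 2 * (m * dy ^ 2) := by
  have h1 := pow_le_pow_left₀ (norm_nonneg _) (h.norm_succ_le t) 2
  have h2 := pow_le_pow_left₀ (norm_nonneg _) (h.norm_grad_le hA hdy t) 2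
  rw [mul_pow, Real.sq_sqrt (Nat.cast_nonneg m)] at h2
  rw [norm_sub_sq_real, inner_smul_right, norm_smul, mul_pow, Real.norm_eq_abs, sq_abs] at h1
  nlinarith [mul_le_mul_of_nonneg_left h2 (sq_nonneg (stepsize m (t + 1)))]

/-- Restoring drift: the strongly feasible impact moved by `dlow` along `p` stays in `Ψ`, which
forces `⟪p, v⟫` to be large, while its reward loses at most `dr`. -/
theorem IsExecution.le_inner_grad (h : R.IsExecution Ω Q C)
    (hA : AssumptionA2 Ω Ψ Q dy dr dlow) (hΨ : Ψ = Q + (C : Set (Vec m))) (hd : 0 ≤ dlow)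
    (t : Fin T) :
    dlow * ‖R.p t.castSucc‖ - dr ≤ inner ℝ (R.p t.castSucc) (R.grad t) := by
  obtain ⟨e, he, her, heb⟩ := hA.strongly_feasible t
  set p := R.p t.castSucc with hp
  have h1 := Dec.reward_sub_inner_le_of_mem_convexHull (h.sol_opt t) he
  have h2 := her _ (h.sol_mem t)
  -- For `p = 0` the quotient is `0` and the point is `e.impact` itself.
  have h3 : inner ℝ p (e.impact + (dlow / ‖p‖) • p) ≤ inner ℝ p (R.v t) := by
    refine inner_le_of_mem_add_cone (h.mem_polarCone _) (h.v_opt t) (hΨ ▸ heb ?_)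
    rw [mem_closedBall_iff_norm, add_sub_cancel_left, norm_smul, Real.norm_eq_abs,
      abs_of_nonneg (by positivity)]
    rcases eq_or_ne ‖p‖ 0 with h0 | h0
    · simpa [h0] using hd
    · rw [div_mul_cancel₀ _ h0]
  rw [inner_add_right, inner_smul_right, real_inner_self_eq_norm_sq] at h3
  have h4 : dlow / ‖p‖ * ‖p‖ ^ 2 = dlow * ‖p‖ := by
    rcases eq_or_ne ‖p‖ 0 with h0 | h0
    · simp [h0]
    · field_simp
  rw [grad, inner_sub_right]
  linarith

/-- The dual multipliers stay bounded. -/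
theorem IsExecution.norm_le (h : R.IsExecution Ω Q C)
    (hA : AssumptionA2 Ω Ψ Q dy dr dlow) (hΨ : Ψ = Q + (C : Set (Vec m))) (hm : 0 < m)
    (hdy : 0 ≤ dy) (hdr : 0 ≤ dr) (hd : 0 < dlow) (t : Fin (T + 1)) :
    ‖R.p t‖ ≤ (dr + dy ^ 2 / 2) / dlow + dy := by
  induction t using Fin.induction with
  | zero => rw [h.init, norm_zero]; positivity
  | succ t ih =>
    have hm' : (0 : ℝ) < m := by exact_mod_cast hm
    have hη := stepsize_pos hm t.val.succ_pos
    have hη1 : stepsize m (t + 1) * m ≤ 1 := by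
      rw [← le_div_iff₀ hm']; exact min_le_left _ _
    -- Above the threshold the drift `2 η ⟪p, g⟫ ≥ η dy²` beats `η² m dy²`, as `η m ≤ 1`, so the
    -- norm does not grow. Below it, one step adds at most `η √m dy ≤ dy`.
    rcases le_total ((dr + dy ^ 2 / 2) / dlow) ‖R.p t.castSucc‖ with hc | hc
    · refine le_trans ?_ ih
      rw [← abs_norm, ← abs_norm (R.p t.castSucc), ← sq_le_sq]
      have h1 := h.norm_sq_succ_le hA hdy t
      have h2 := h.le_inner_grad hA hΨ hd.le t
      rw [div_le_iff₀ hd] at hc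
      have h3 : dy ^ 2 / 2 ≤ inner ℝ (R.p t.castSucc) (R.grad t) := by linarith
      have h4 := mul_le_mul_of_nonneg_left h3 hη.le
      have h5 := mul_le_mul_of_nonneg_right hη1 (mul_nonneg hη.le (sq_nonneg dy))
      nlinarith
    · have h1 := (h.norm_succ_le t).trans (norm_sub_le _ _)
      rw [norm_smul, Real.norm_eq_abs, abs_of_pos hη] at h1
      have h2 := mul_le_mul_of_nonneg_left (h.norm_grad_le hA hdy t) hη.le
      have h3 : Real.sqrt m ≤ m := by
        rw [Real.sqrt_le_left hm'.le]
        have : (1 : ℝ) ≤ m := by exact_mod_cast hm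
        nlinarith
      have h4 : stepsize m (t + 1) * (Real.sqrt m * dy) ≤ dy := by
        calc _ ≤ stepsize m (t + 1) * (m * dy) := by gcongr
          _ = stepsize m (t + 1) * m * dy := by ring
          _ ≤ 1 * dy := by gcongr
          _ = dy := one_mul _
      linarith

/-- The regret bound of projected subgradient descent against the comparator `0`. -/
theorem IsExecution.sum_inner_grad_le (h : R.IsExecution Ω Q C)
    (hA : AssumptionA2 Ω Ψ Q dy dr dlow) (hdy : 0 ≤ dy) (hm : 0 < m) (hmT : m ≤ T) {D : ℝ}
    (hD : ∀ t, ‖R.p t‖ ≤ D) :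
    ∑ t : Fin T, inner ℝ (R.p t.castSucc) (R.grad t) ≤ (D ^ 2 + dy ^ 2) * Real.sqrt (m * T) := by
  have hpos : ∀ t : ℕ, 0 < stepsize m (t + 1) := fun t => stepsize_pos hm t.succ_pos
  have hstep : ∀ t : Fin T, inner ℝ (R.p t.castSucc) (R.grad t)
      ≤ (stepsize m (t + 1))⁻¹ * (‖R.p t.castSucc‖ ^ 2 - ‖R.p t.succ‖ ^ 2) / 2
        + m * stepsize m (t + 1) * dy ^ 2 / 2 := fun t => by
    have h1 := h.norm_sq_succ_le hA hdy t
    have h2 := hpos t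
    rw [← mul_le_mul_iff_right₀ (mul_pos two_pos h2)]
    have : 2 * stepsize m (t + 1) * ((stepsize m (t + 1))⁻¹
        * (‖R.p t.castSucc‖ ^ 2 - ‖R.p t.succ‖ ^ 2) / 2 + m * stepsize m (t + 1) * dy ^ 2 / 2)
        = (‖R.p t.castSucc‖ ^ 2 - ‖R.p t.succ‖ ^ 2) + stepsize m (t + 1) ^ 2 * (m * dy ^ 2) := by
      field_simp
    rw [this]
    linarith
  refine (Finset.sum_le_sum fun t _ => hstep t).trans ?_
  rw [Finset.sum_add_distrib, ← Finset.sum_div, ← Finset.sum_div, ← Finset.sum_mul]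
  have hD2 : ∀ t, ‖R.p t‖ ^ 2 ≤ D ^ 2 := fun t => pow_le_pow_left₀ (norm_nonneg _) (hD t) 2
  have h1 := sum_mul_sub_succ_le (a := fun t => (stepsize m (t + 1))⁻¹)
    (fun s t hst => inv_anti₀ (hpos t) (stepsize_anti hm s.succ_pos (by omega)))
    (inv_pos.2 (hpos 0)).le (fun t => ‖R.p t‖ ^ 2) hD2
  have h2 : (stepsize m (T + 1))⁻¹ * (D ^ 2 - ‖R.p (Fin.last T)‖ ^ 2)
      ≤ 2 * Real.sqrt (m * T) * D ^ 2 :=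
    mul_le_mul (inv_stepsize_le hm hmT) (by linarith [sq_nonneg ‖R.p (Fin.last T)‖])
      (sub_nonneg.2 (hD2 _)) (by positivity)
  have h3 := mul_le_mul_of_nonneg_right (sum_stepsize_le hm T) (sq_nonneg dy)
  linarith

/-- The reward collected in one step, compared with a decision `e` in the convex hull of the
local set and a target impact `y` in `Ψ`. -/
theorem IsExecution.reward_ge (h : R.IsExecution Ω Q C) {t : Fin T} {e : Dec (n t) m}
    (he : e ∈ convexHull ℝ (Ω t)) {y : Vec m} (hy : y ∈ Q + (C : Set (Vec m))) :
    e.reward - inner ℝ (R.p t.castSucc) (e.impact - y) - inner ℝ (R.p t.castSucc) (R.grad t)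
      ≤ (R.sol t).reward := by
  have h1 := Dec.reward_sub_inner_le_of_mem_convexHull (h.sol_opt t) he
  have h2 := inner_le_of_mem_add_cone (h.mem_polarCone t.castSucc) (h.v_opt t) hy
  rw [grad, inner_sub_right, inner_sub_right]
  linarith

/-- The multiplier of step `t` is determined by the arrivals before step `t`. -/
theorem Nonanticipating.p_eq {Z : ∀ τ, Set (Dec (n τ) m)}
    {R : ∀ π : Equiv.Perm (Fin T), Run m (fun t => n (π t))} (hR : Nonanticipating R)
    (h : ∀ π, (R π).IsExecution (fun t => Z (π t)) Q C) (π π' : Equiv.Perm (Fin T))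
    (t : Fin (T + 1)) (heq : ∀ s : Fin T, s.val < t.val → π s = π' s) :
    (R π).p t = (R π').p t := by
  induction t using Fin.induction with
  | zero => rw [(h π).init, (h π').init]
  | succ t ih =>
    have hp := ih fun s hs => heq s (hs.trans (Nat.lt_succ_self _))
    obtain ⟨h1, h2⟩ := hR π π' t fun s hs => heq s (Nat.lt_succ_of_le hs)
    have h3 : ((R π).sol t).impact = ((R π').sol t).impact :=
      -- The decisions live in types indexed by `π t` and `π' t`; the update needs only their
      -- impacts, which share one type.
      congrArg (fun e : (τ : Fin T) × Dec (n τ) m => e.2.impact) h1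
    have h4 := (h π).step_proj t
    rw [hp, h2, h3] at h4
    exact (convex_polarCone C).eq_of_forall_dist_le ((h π).step_mem t) ((h π').step_mem t) h4
      ((h π').step_proj t)

end Run

/-! ### Attainment of the relaxed optimum -/

theorem AssumptionA1.isGreatest_zR {m T : ℕ} {n : Fin T → ℕ} {Z : ∀ τ, Set (Dec (n τ) m)}
    {Ψ Q : Set (Vec m)} {C : ProperCone ℝ (Vec m)} (h : AssumptionA1 Z Ψ Q C) (hT : 0 < T) :
    IsGreatest (relaxedValues Z Ψ) (zR Z Ψ) := by
  have hΨ : IsClosed ((T : ℝ) • Ψ) := by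
    refine IsClosed.smul_of_ne_zero ?_ (by exact_mod_cast hT.ne')
    rw [h.motzkin]
    exact C.isClosed.add_left_of_isCompact h.isCompact_Q
  have himp : Continuous fun e : ∀ t, Dec (n t) m => ∑ t, (e t).impact :=
    continuous_finsetSum _ fun t _ => Dec.continuous_impact.comp (continuous_apply t)
  have hrew : Continuous fun e : ∀ t, Dec (n t) m => ∑ t, (e t).reward :=
    continuous_finsetSum _ fun t _ => Dec.continuous_reward.comp (continuous_apply t)
  have heq : relaxedValues Z Ψ = (fun e : ∀ t, Dec (n t) m => ∑ t, (e t).reward) ''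
      (Set.univ.pi (fun t => convexHull ℝ (Z t)) ∩
        (fun e : ∀ t, Dec (n t) m => ∑ t, (e t).impact) ⁻¹' ((T : ℝ) • Ψ)) := by
    ext z
    constructor
    · rintro ⟨e, h1, h2, rfl⟩
      exact ⟨e, ⟨fun t _ => h1 t, h2⟩, rfl⟩
    · rintro ⟨e, ⟨h1, h2⟩, rfl⟩
      exact ⟨e, fun t => h1 t trivial, h2, rfl⟩
  have hcomp : IsCompact (relaxedValues Z Ψ) := by
    rw [heq]
    exact ((isCompact_univ_pi fun t =>
      (h.isCompact_local t).convexHull_of_finiteDimensional).inter_right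
        (hΨ.preimage himp)).image hrew
  have hne : (relaxedValues Z Ψ).Nonempty := by
    obtain ⟨e, h1, h2⟩ := h.feasible
    exact ⟨_, e, fun t => subset_convexHull ℝ _ (h1 t), h2, rfl⟩
  exact hcomp.isGreatest_sSup hne

/-! ### Concentration of predictable weightings -/

section Concentration

open Finset

variable {m T : ℕ} {p : Fin T → Equiv.Perm (Fin T) → Vec m} {w : Fin T → Vec m} {D β L : ℝ}

theorem remainingMean_apply (w : Fin T → Vec m) (π : Equiv.Perm (Fin T)) (t : ℕ) (i : Fin m) :
    (remainingMean w π t) i = remainingMean (fun τ => w τ i) π t := by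
  simp [remainingMean]

/-- Given the past, `p t` is fixed and `w (π t)` has mean `remainingMean w π t`. -/
theorem isPermMartingaleDiff_inner_sub_remainingMean
    (hp : ∀ s t u : Fin T, s ≤ t → t ≤ u → ∀ π, p s (π * Equiv.swap t u) = p s π) :
    IsPermMartingaleDiff fun t π => inner ℝ (p t π) (w (π t) - remainingMean w π t) where
  adapted s t u hs hu π := by
    have hs' : s.val < t.val := hs
    have hu' : t.val ≤ u.val := hu
    have h1 : (π * Equiv.swap t u) s = π s := by
      rw [Equiv.Perm.mul_apply, Equiv.swap_apply_of_ne_of_ne hs.ne (hs.trans_le hu).ne]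
    rw [hp s t u hs.le hu, h1, remainingMean_mul_swap w π (by omega) (by omega)]
  mean_zero t π := by
    rw [sum_congr rfl fun s hs => by
      rw [hp t t s le_rfl (mem_Ici.1 hs),
        remainingMean_mul_swap w π le_rfl (Fin.le_def.1 (mem_Ici.1 hs))],
      ← inner_sum, sum_sub_distrib, sum_Ici_mul_swap, sum_const, ← Nat.cast_smul_eq_nsmul ℝ,
      card_Ici_cast, sub_self, inner_zero_right]

theorem permProb_sum_inner_sub_remainingMean_ge_le
    (hp : ∀ s t u : Fin T, s ≤ t → t ≤ u → ∀ π, p s (π * Equiv.swap t u) = p s π)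
    (hD : 0 < D) (hβ : 0 < β) (hL : 0 ≤ L) (hm : 0 < m) (hT : 0 < T)
    (hpD : ∀ t π, ‖p t π‖ ≤ D) (hw : ∀ τ i, |w τ i| ≤ β) :
    permProb {π | 3 * D * β * Real.sqrt (m * T * L)
      ≤ ∑ t, inner ℝ (p t π) (w (π t) - remainingMean w π t)} ≤ Real.exp (-L) := by
  have hm' : (0 : ℝ) < m := by exact_mod_cast hm
  have hT' : (0 : ℝ) < T := by exact_mod_cast hT
  refine ((isPermMartingaleDiff_inner_sub_remainingMean hp).permProb_sum_ge_le
    (c := fun _ => D * (Real.sqrt m * (2 * β))) (V := 4 * D ^ 2 * β ^ 2 * (m * T)) (fun t π => ?_)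
    (by positivity) ?_ (by positivity)).trans ?_
  · refine (abs_real_inner_le_norm _ _).trans (mul_le_mul (hpD t π) ?_ (norm_nonneg _) hD.le)
    refine EuclideanSpace.norm_le_sqrt_mul (by positivity) fun i => ?_
    rw [PiLp.sub_apply, remainingMean_apply]
    refine (abs_sub _ _).trans ?_
    linarith [hw (π t) i, abs_remainingMean_le (fun τ => w τ i) (fun τ => hw τ i) π t]
  · rw [sum_const, card_univ, Fintype.card_fin, nsmul_eq_mul, mul_pow, mul_pow,
      Real.sq_sqrt hm'.le]
    exact le_of_eq (by ring)
  -- The exponent is `-(9 / 8) * L`.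
  · refine Real.exp_le_exp.2 ?_
    rw [mul_pow, Real.sq_sqrt (by positivity), div_le_iff₀ (by positivity)]
    have : 0 ≤ L * (D ^ 2 * β ^ 2 * (m * T)) := by positivity
    nlinarith

theorem permProb_exists_abs_remainingMean_ge_le (hβ : 0 < β) (hL : 0 ≤ L)
    (hw : ∀ τ i, |w τ i| ≤ β) (hw0 : ∑ τ, w τ = 0) :
    permProb {π | ∃ (t : Fin T) (i : Fin m),
      8 * β * Real.sqrt (L / ((T : ℝ) - t)) ≤ |(remainingMean w π t) i|}
      ≤ 2 * (m * T * Real.exp (-(4 * L))) := by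
  have hw0i : ∀ i, ∑ τ, w τ i = 0 := fun i => by
    simpa using congrArg (fun v : Vec m => v i) hw0
  have hone : ∀ (a : Fin T → ℝ), (∀ τ, |a τ| ≤ β) → ∑ τ, a τ = 0 → ∀ t : Fin T,
      permProb {π | 8 * β * Real.sqrt (L / ((T : ℝ) - t)) ≤ remainingMean a π t}
        ≤ Real.exp (-(4 * L)) := by
    intro a ha ha0 t
    have hk : (0 : ℝ) < (T : ℝ) - t := sub_pos.2 (by exact_mod_cast t.2)
    -- `8 ^ 2 / 16 = 4`; the factor `4` in `4 * L` later absorbs the union bound over `2 m T`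
    -- events.
    refine (permProb_remainingMean_ge_le a hβ ha ha0 t (by positivity)).trans_eq ?_
    rw [mul_pow, Real.sq_sqrt (by positivity)]
    congr 1; field_simp; ring
  have hsub : {π | ∃ (t : Fin T) (i : Fin m),
      8 * β * Real.sqrt (L / ((T : ℝ) - t)) ≤ |(remainingMean w π t) i|}
      ⊆ ⋃ q ∈ (univ : Finset (Fin T × Fin m)),
        ({π | 8 * β * Real.sqrt (L / ((T : ℝ) - q.1))
            ≤ remainingMean (fun τ => w τ q.2) π q.1}
          ∪ {π | 8 * β * Real.sqrt (L / ((T : ℝ) - q.1))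
            ≤ remainingMean (fun τ => -w τ q.2) π q.1}) := by
    rintro π ⟨t, i, h⟩
    simp only [Set.mem_iUnion]
    refine ⟨(t, i), mem_univ _, ?_⟩
    rw [remainingMean_apply, le_abs] at h
    refine h.imp id fun h => ?_
    have : remainingMean (fun τ => -w τ i) π t = -remainingMean (fun τ => w τ i) π t := by
      simp [remainingMean]
    exact h.trans_eq this.symm
  refine (permProb_mono hsub).trans ((permProb_biUnion_le _ _).trans ?_)
  refine (sum_le_sum fun q _ => (permProb_union_le _ _).trans (add_le_add
    (hone _ (fun τ => hw τ q.2) (hw0i q.2) q.1)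
    (hone _ (fun τ => (abs_neg _).trans_le (hw τ q.2)) (by simp [hw0i]) q.1))).trans_eq ?_
  simp only [sum_const, card_univ, Fintype.card_prod, Fintype.card_fin, nsmul_eq_mul,
    Nat.cast_mul]
  ring

/-- A predictable bounded weighting of the elements of a centered population, drawn without
replacement, has small total. -/
theorem permProb_sum_inner_ge_le
    (hp : ∀ s t u : Fin T, s ≤ t → t ≤ u → ∀ π, p s (π * Equiv.swap t u) = p s π)
    (hD : 0 < D) (hβ : 0 < β) (hL : 0 ≤ L) (hm : 0 < m) (hT : 0 < T)
    (hpD : ∀ t π, ‖p t π‖ ≤ D) (hw : ∀ τ i, |w τ i| ≤ β) (hw0 : ∑ τ, w τ = 0) :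
    permProb {π | 19 * D * β * Real.sqrt (m * T * L) < ∑ t, inner ℝ (p t π) (w (π t))}
      ≤ Real.exp (-L) + 2 * (m * T * Real.exp (-(4 * L))) := by
  refine le_trans (permProb_mono ?_) ((permProb_union_le _ _).trans (add_le_add
    (permProb_sum_inner_sub_remainingMean_ge_le hp hD hβ hL hm hT hpD hw)
    (permProb_exists_abs_remainingMean_ge_le hβ hL hw hw0)))
  intro π hπ
  by_contra hcon
  simp only [Set.mem_union, Set.mem_ofPred_eq, not_or, not_exists, not_le] at hcon hπ
  obtain ⟨h1, h2⟩ := hcon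
  have h3 : ∑ t, inner ℝ (p t π) (remainingMean w π t)
      ≤ ∑ t : Fin T, D * (Real.sqrt m * (8 * β * Real.sqrt L)) * (1 / Real.sqrt ((T : ℝ) - t)) := by
    refine sum_le_sum fun t _ => (real_inner_le_norm _ _).trans ?_
    have h4 := EuclideanSpace.norm_le_sqrt_mul (x := remainingMean w π t) (by positivity)
      fun i => (h2 t i).le
    refine (mul_le_mul (hpD t π) h4 (norm_nonneg _) hD.le).trans_eq ?_
    rw [Real.sqrt_div hL]; ring
  rw [← mul_sum] at h3
  -- This sum contributes `8 * 2 = 16`; with the martingale part, `19 = 3 + 16`.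
  have h5 := mul_le_mul_of_nonneg_left (sum_inv_sqrt_sub_le T)
    (show 0 ≤ D * (Real.sqrt m * (8 * β * Real.sqrt L)) by positivity)
  have h6 : Real.sqrt (m * T * L) = Real.sqrt m * Real.sqrt T * Real.sqrt L := by
    rw [Real.sqrt_mul (by positivity), Real.sqrt_mul (by positivity)]
  have h7 : ∑ t, inner ℝ (p t π) (w (π t))
      = ∑ t, inner ℝ (p t π) (w (π t) - remainingMean w π t)
        + ∑ t, inner ℝ (p t π) (remainingMean w π t) := by
    rw [← sum_add_distrib]
    exact sum_congr rfl fun t _ => by rw [← inner_add_right, sub_add_cancel]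
  rw [h7] at hπ
  rw [h6] at hπ h1
  linarith

end Concentration

/-! ### Assembly of the bound -/

section Main

open Finset

variable {m T : ℕ} {n : Fin T → ℕ} {Z : ∀ τ, Set (Dec (n τ) m)} {Ψ Q : Set (Vec m)}
  {C : ProperCone ℝ (Vec m)} {dy dr dlow : ℝ}

theorem AssumptionA2.comp_perm (h : AssumptionA2 Z Ψ Q dy dr dlow) (π : Equiv.Perm (Fin T)) :
    AssumptionA2 (fun t => Z (π t)) Ψ Q dy dr dlow :=
  ⟨fun t => h.impact_bound (π t), fun t => h.strongly_feasible (π t)⟩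

/-- The impacts of an optimal solution of the relaxation, centered at a point of `Ψ`. -/
theorem AssumptionA1.exists_centered_optimum (h1 : AssumptionA1 Z Ψ Q C)
    (h2 : AssumptionA2 Z Ψ Q dy dr dlow) (hT : 0 < T) :
    ∃ (e : ∀ τ, Dec (n τ) m) (y : Vec m), (∀ τ, e τ ∈ convexHull ℝ (Z τ)) ∧
      y ∈ Q + (C : Set (Vec m)) ∧ zR Z Ψ = ∑ τ, (e τ).reward ∧
      ∑ τ, ((e τ).impact - y) = 0 ∧ ∀ τ i, |((e τ).impact - y) i| ≤ 2 * dy := by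
  obtain ⟨e, he, hsum, hz⟩ := (h1.isGreatest_zR hT).1
  obtain ⟨y, hy, hye⟩ := Set.mem_smul_set.1 hsum
  rw [h1.motzkin] at hy
  have hT' : (0 : ℝ) < T := by exact_mod_cast hT
  refine ⟨e, y, he, hy, hz, ?_, fun τ i => ?_⟩
  · rw [sum_sub_distrib, sum_const, card_univ, Fintype.card_fin, ← Nat.cast_smul_eq_nsmul ℝ, hye,
      sub_self]
  -- The `Q`-part `v` of `y` is within `dy` of every impact coordinatewise, hence of their average
  -- `y`; the triangle inequality gives `2 * dy`.
  · obtain ⟨v, hv, -⟩ := hy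
    have hb : ∀ τ, |(e τ).impact i - v i| ≤ dy := fun τ =>
      Dec.abs_impact_sub_le_of_mem_convexHull (fun f hf => h2.impact_bound τ f hf v hv i) (he τ)
    have hyi : (T : ℝ) * (y i - v i) = ∑ τ, ((e τ).impact i - v i) := by
      have := congrArg (fun x : Vec m => x i) hye
      simp only [PiLp.smul_apply, smul_eq_mul, WithLp.ofLp_sum, Finset.sum_apply] at this
      rw [sum_sub_distrib, ← this, sum_const, card_univ, Fintype.card_fin, nsmul_eq_mul]
      ring
    have hyb : |y i - v i| ≤ dy := by
      refine le_of_mul_le_mul_left ?_ hT'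
      rw [← abs_of_pos hT', ← abs_mul, abs_of_pos hT', hyi]
      refine (abs_sum_le_sum_abs _ _).trans ((sum_le_sum fun τ _ => hb τ).trans_eq ?_)
      simp
    rw [PiLp.sub_apply, show (e τ).impact i - y i = ((e τ).impact i - v i) - (y i - v i) by ring]
    exact (abs_sub _ _).trans (by linarith [hb τ])

/-- The first term is at most `ρ / 2`; the second is at most `ρ ^ 4 / 2`, using `m ≤ T` to absorb `m
* T`. -/
theorem exp_neg_log_add_le {ρ : ℝ} (hρ : 0 < ρ) (hρ1 : ρ ≤ 1) (hT : 2 ≤ T) (hmT : m ≤ T) :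
    Real.exp (-Real.log (T / ρ)) + 2 * (m * T * Real.exp (-(4 * Real.log (T / ρ)))) ≤ ρ := by
  have hT' : (2 : ℝ) ≤ T := by exact_mod_cast hT
  have hmT' : (m : ℝ) ≤ T := by exact_mod_cast hmT
  have h1 : Real.exp (-Real.log (T / ρ)) = ρ / T := by
    rw [← Real.log_inv, Real.exp_log (by positivity), inv_div]
  have h2 : Real.exp (-(4 * Real.log (T / ρ))) = (ρ / T) ^ 4 := by
    rw [← h1, ← Real.exp_nat_mul]; congr 1; push_cast; ring
  rw [h2, h1]
  have h3 : ρ / T ≤ ρ / 2 := by gcongr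
  have h4 : (ρ / T) ^ 2 ≤ (ρ / 2) ^ 2 := by gcongr
  have h5 : (m : ℝ) * T * (ρ / T) ^ 2 ≤ ρ ^ 2 := by
    rw [div_pow, mul_div_assoc', div_le_iff₀ (by positivity)]
    nlinarith [mul_le_mul_of_nonneg_right hmT' (show 0 ≤ T * ρ ^ 2 by positivity)]
  have h6 : (m : ℝ) * T * (ρ / T) ^ 4 ≤ ρ ^ 2 * (ρ / 2) ^ 2 := by
    calc (m : ℝ) * T * (ρ / T) ^ 4 = (m * T * (ρ / T) ^ 2) * (ρ / T) ^ 2 := by ring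
      _ ≤ _ := by gcongr
  have h7 : ρ ^ 4 ≤ ρ := pow_le_of_le_one hρ.le hρ1 (by norm_num)
  nlinarith

/-- `38 = 19 * 2` comes from `β = 2 * (dy + 1)`; the `+ 1` in `D` and `β` ensures positivity. -/
theorem permProb_totalReward_ge {R : ∀ π : Equiv.Perm (Fin T), Run m (fun t => n (π t))}
    (hdy : 0 ≤ dy) (hdr : 0 ≤ dr) (hd : 0 < dlow) (hm : 0 < m) (hmT : m ≤ T)
    (h1 : AssumptionA1 Z Ψ Q C) (h2 : AssumptionA2 Z Ψ Q dy dr dlow)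
    (hR : ∀ π, (R π).IsExecution (fun t => Z (π t)) Q C) (hna : Run.Nonanticipating R)
    {ρ D : ℝ} (hρ : 0 < ρ) (hρ1 : ρ ≤ 1) (hD : D = (dr + dy ^ 2 / 2) / dlow + dy + 1) :
    1 - ρ ≤ permProb {π | (R π).totalReward ≥ zR Z Ψ
      - (38 * D * (dy + 1) + 2 * (D ^ 2 + dy ^ 2)) * Real.sqrt (m * T * Real.log (T / ρ))} := by
  have hT : 0 < T := hm.trans_le hmT
  have hD0 : 0 < D := by rw [hD]; positivity
  obtain ⟨e, y, he, hy, hz, hsum, hb⟩ := h1.exists_centered_optimum h2 hT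
  have hreward : ∀ π, zR Z Ψ - ∑ t : Fin T, inner ℝ ((R π).p t.castSucc) ((e (π t)).impact - y)
      - ∑ t : Fin T, inner ℝ ((R π).p t.castSucc) ((R π).grad t) ≤ (R π).totalReward := fun π => by
    rw [hz, ← Equiv.sum_comp π fun τ => (e τ).reward, ← sum_sub_distrib, ← sum_sub_distrib]
    exact sum_le_sum fun t _ => (hR π).reward_ge (he (π t)) hy
  have hpD : ∀ π t, ‖(R π).p t‖ ≤ D := fun π t => by
    have := (hR π).norm_le (h2.comp_perm π) h1.motzkin hm hdy hdr hd t
    linarith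
  set L := Real.log (T / ρ) with hLdef
  set A := {π | (R π).totalReward ≥ zR Z Ψ
      - (38 * D * (dy + 1) + 2 * (D ^ 2 + dy ^ 2)) * Real.sqrt (m * T * L)} with hA
  suffices h : permProb Aᶜ ≤ ρ by rw [permProb_compl] at h; linarith
  -- For `T = 1` the value `L` may vanish, but the only multiplier used is `0`, so there is no loss.
  -- For `T ≥ 2`, `L ≥ 1 / 4` gives `√(mT) ≤ 2 √(mTL)`.
  rcases (show T = 1 ∨ 2 ≤ T by omega) with hT1 | hT2
  · have hempty : Aᶜ = ∅ := by
      rw [Set.compl_empty_iff, Set.eq_univ_iff_forall]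
      intro π
      have hp0 : ∀ t : Fin T, (R π).p t.castSucc = 0 := fun t => by
        rw [← (hR π).init]; congr 1; ext; simp; omega
      have h := hreward π
      simp only [hp0, inner_zero_left, sum_const_zero, sub_zero] at h
      have : 0 ≤ (38 * D * (dy + 1) + 2 * (D ^ 2 + dy ^ 2)) * Real.sqrt (m * T * L) := by
        positivity
      rw [hA, Set.mem_ofPred_eq]
      linarith
    rw [hempty]
    simpa [permProb] using hρ.le
  have hTL : (2 : ℝ) ≤ T / ρ := by
    rw [le_div_iff₀ hρ]
    have : (2 : ℝ) ≤ T := by exact_mod_cast hT2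
    linarith
  have hL : 1 / 4 ≤ L := by
    have := Real.log_le_log two_pos hTL
    linarith [Real.log_two_gt_d9]
  refine le_trans (permProb_mono ?_) ((permProb_sum_inner_ge_le
    (p := fun t π => (R π).p t.castSucc) (w := fun τ => (e τ).impact - y) (D := D)
    (β := 2 * (dy + 1)) (L := L) ?_ hD0 (by positivity) (by linarith) hm hT
    (fun t π => hpD π _) (fun τ i => (hb τ i).trans (by linarith)) hsum).trans
    (exp_neg_log_add_le hρ hρ1 hT2 hmT))
  · intro π hπ
    rw [hA, Set.mem_compl_iff, Set.mem_ofPred_eq, not_le] at hπ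
    rw [Set.mem_ofPred_eq]
    have h3 := (hR π).sum_inner_grad_le (h2.comp_perm π) hdy hm hmT (hpD π)
    have h4 : Real.sqrt (m * T) ≤ 2 * Real.sqrt (m * T * L) := by
      rw [Real.sqrt_le_left (by positivity), mul_pow, Real.sq_sqrt (by positivity)]
      nlinarith [mul_le_mul_of_nonneg_left hL (show (0 : ℝ) ≤ m * T by positivity)]
    have h5 := mul_le_mul_of_nonneg_left h4 (show 0 ≤ D ^ 2 + dy ^ 2 by positivity)
    linarith [hreward π]
  · intro s t u hs hu π
    refine hna.p_eq hR _ _ _ fun r hr => ?_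
    have hr' : r < t := lt_of_lt_of_le (Fin.lt_def.2 hr) hs
    rw [Equiv.Perm.mul_apply, Equiv.swap_apply_of_ne_of_ne hr'.ne (hr'.trans_le hu).ne]

end Main

theorem mainTheorem4 (dy dr dlow : ℝ) (hdy : 0 ≤ dy) (hdr : 0 ≤ dr) (hdlow : 0 < dlow) :
    ∃ K : ℝ, 0 < K ∧
      ∀ (m T : ℕ), 0 < m → m ≤ T →
      ∀ (n : Fin T → ℕ) (Z : ∀ τ, Set (Dec (n τ) m)) (Ψ Q : Set (Vec m))
        (C : ProperCone ℝ (Vec m)),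
      AssumptionA1 Z Ψ Q C →
      AssumptionA2 Z Ψ Q dy dr dlow →
      IsGreatest (relaxedValues Z Ψ) (zR Z Ψ) ∧
      ∀ R : ∀ π : Equiv.Perm (Fin T), Run m (fun t => n (π t)),
      (∀ π, (R π).IsExecution (fun t => Z (π t)) Q C) →
      Run.Nonanticipating R →
      ∀ ρ : ℝ, 0 < ρ → ρ ≤ 1 →
        1 - ρ ≤ permProb {π | (R π).totalReward ≥
          zR Z Ψ - K * (Real.sqrt (m * Real.log m) * Real.sqrt T
            + Real.sqrt (m * T * Real.log (T / ρ)))} := by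
  set D := (dr + dy ^ 2 / 2) / dlow + dy + 1 with hD
  have hD0 : 0 < D := by positivity
  refine ⟨38 * D * (dy + 1) + 2 * (D ^ 2 + dy ^ 2), by positivity, ?_⟩
  intro m T hm hmT n Z Ψ Q C h1 h2
  refine ⟨h1.isGreatest_zR (hm.trans_le hmT), fun R hR hna ρ hρ hρ1 => ?_⟩
  refine (permProb_totalReward_ge hdy hdr hdlow hm hmT h1 h2 hR hna hρ hρ1 hD).trans
    (permProb_mono fun π hπ => ?_)
  rw [Set.mem_ofPred_eq] at hπ ⊢
  refine le_trans (sub_le_sub_left (mul_le_mul_of_nonneg_left ?_ (by positivity)) _) hπ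
  -- The `√(m log m)` term is not needed: `m ≤ T` already puts the union bound over coordinates into
  -- `log (T / ρ)`.
  exact le_add_of_nonneg_left (by positivity)
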